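/- **Setting.** Let $G=(V,E)$ be a finite undirected graph with $n=|V|\ge 3$ vertices and positive edge weights $w$; let $k=\ln n$, $d\ge 2$ an integer, $c\ge 1$ and $\rho\ge 0$ real, and $s=4e\,d^{c+1}\ln^2 n+1$. The length of a path is the sum of its edge weights, and $\delta_H$ denotes distance in $H$. *Tree covers.* For disjoint $R,S\subseteq V$, an $S$-restricted tree cover of $G-R$ is a family of trees $T(x)\subseteq G-R$ ($x\in S$), $T(x)$ rooted at $x$, such that (i) for all $a\in S$, $b\in V\setminus R$ with $\delta_{G-R}(a,b)<\infty$ some $T(x)$ contains $a$ and $b$ and $\mathrm{dep}_{T(x)}(a)+\mathrm{dep}_{T(x)}(b)\le(2k-1)\delta_{G-R}(a,b)$, where $\mathrm{dep}_T$ is the weighted distance to the root in $T$, and (ii) every vertex lies in at most $kn^{1/k}(\ln n+1)$ of the trees. For all $R,S$ fix an $(S\setminus R)$-restricted tree cover $\mathcal T_R(S)$ of $G-R$, depending only on $R$ and $S\setminus R$, and put $\mathcal T(S)=\mathcal T_\varnothing(S)$. A trunk vertex of a tree $T$ of an $S$-restricted cover is a vertex on the path in $T$ between two vertices of $S$; the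 pseudo-degree of a vertex in $T$ is its degree in the subgraph of $T$ induced by the trunk vertices ($0$ for non-trunk vertices). $\mathrm{Hi}(\cdot)$ is the set of vertices of pseudo-degree $>s$ in some tree of the cover. *Hierarchy.* The hierarchy tree has root $V$; a node $A$ is a leaf if $\mathrm{Hi}(\mathcal T(A))=\varnothing$, and otherwise has children $W_1=\mathrm{Hi}(\mathcal T(A))$ and $W_{j}=W_{j-1}\cup\mathrm{Hi}(\mathcal T_{W_{j-1}}(A))$ for $2\le j\le d$. Let $V=U_1,\dots,U_p$ be a path in it starting at the root, and $U_{p+1}=\varnothing$. Let $\mathcal T$ be the family of all trees of $\mathcal T_{U_{i+1}}(U_i)$, $1\le i\le p$, each pruned by deleting the vertices of depth $>(2k-1)\rho$; a tree with index $i$ has its trunk taken, after pruning, with respect to $U_i\setminus U_{i+1}$. *Data structure.* Let $\Lambda$ be the concatenation, in some order, of Euler tours (depth-first discovery orders from the root) of the trees of $\mathcal T$. Let $\mathcal I$ be a $\kappa$-covering set of $\Lambda$ for some $\kappa$: a set of intervals of positions of $\Lambda$ such that each interval is the union of at most $\kappa$ members of $\mathcal I$. The digraph $H$ has as vertices two copies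 $I_1,I_2$ of each $I\in\mathcal I$, two copies $T_1,T_2$ of each $T\in\mathcal T$, and all $x\in V$. Its edges are $I_1\to T_1$ and $T_2\to I_2$ whenever an edge of $G$ of weight $\le\rho$ joins a vertex of $I$ to a vertex of $T$, and $T_1\to x$ and $x\to T_2$ whenever $x\in V(T)$. $E'$ is the set of pairs of positions of $\Lambda$ whose vertices are equal or are joined by an edge of $G$ of weight $\le\rho$. *Query.* Let $D\subseteq V$, $|D|\le d$, and $u,v\in V\setminus D$. A tree $T\in\mathcal T$ is affected if $V(T)\cap D\ne\varnothing$; its affected subtrees are the connected components of $T-D$ that contain a trunk vertex of $T$. A vertex is affected if it lies in some affected subtree, and unaffected otherwise. The nodes of the query graph $R$ are $\{u\}$, $\{v\}$ and all affected subtrees, considered as vertex sets, each represented as a union of intervals from $\mathcal I$ (intervals being read as the sets of vertices occurring in them). For nodes $X,Y$ (possibly $X=Y$), there is an undirected edge $(X,Y)\in E(R)$ iff there are intervals $I$ in the representation of $X$ and $J$ in that of $Y$, or vice versa, such that $I_1$ can reach $J_2$ in $H$ after deletion of both copies of all affected trees, or $E'\cap(I\times J)\neq\varnothing$. An unaffected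 path connecting $X$ and $Y$ is a path $(v_0,\dots,v_\ell)$, $\ell\ge 0$, in $G-D$ with $v_0\in X$, $v_\ell\in Y$ and $v_1,\dots,v_{\ell-1}$ unaffected. **Theorem.** For every choice of the above data and all nodes $X,Y$ of $R$: (a) if there is an unaffected path of length $\le\rho$ connecting $X$ and $Y$, then $(X,Y)\in E(R)$; (b) if $(X,Y)\in E(R)$, then there is a path in $G-D$ that starts at a vertex of $X$, ends at a vertex of $Y$, and has length at most $(8k-2)\rho$. -/

import Mathlib

namespace VSDO

/-! ### Weighted graphs -/

/-- The length of a walk, for edge weights `w`. -/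
noncomputable def wlen {V : Type*} {H : SimpleGraph V} (w : Sym2 V → ℝ) {a b : V}
    (q : H.Walk a b) : ℝ :=
  (q.edges.map w).sum

/-- The weighted distance between `a` and `b` in `H`. It is only used for vertices that are
connected in `H`. -/
noncomputable def wdist {V : Type*} (H : SimpleGraph V) (w : Sym2 V → ℝ) (a b : V) : ℝ :=
  sInf {L : ℝ | ∃ q : H.Walk a b, wlen w q = L}

/-- The graph `G - R`. -/
def minus {V : Type*} (G : SimpleGraph V) (R : Set V) : G.Subgraph :=
  (⊤ : G.Subgraph).deleteVerts R

/-- The parameter `k = ln n`, where `n = |V|`. -/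
noncomputable def kpar (V : Type*) [Fintype V] : ℝ := Real.log (Fintype.card V)

/-! ### Rooted trees and source-restricted tree covers -/

/-- A rooted tree that is a subgraph of `G`. -/
structure RootedTree {V : Type*} (G : SimpleGraph V) where
  /-- the tree, as a subgraph of `G` -/
  graph : G.Subgraph
  /-- the root -/
  root : V
  root_mem : root ∈ graph.verts
  isTree : graph.coe.IsTree

/-- The depth of `x` in the tree `T`: the weighted distance to the root inside `T`. -/
noncomputable def RootedTree.dep {V : Type*} {G : SimpleGraph V} (w : Sym2 V → ℝ)
    (T : RootedTree G) (x : V) : ℝ :=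
  wdist T.graph.spanningCoe w T.root x

/-- `T` (restricted to the indices in `S`) is an `S`-restricted tree cover of the graph `G - R`,
where `S ⊆ V \ R`. The stretch condition concerns pairs at finite distance. -/
structure IsTreeCover {V : Type*} [Fintype V] (G : SimpleGraph V) (w : Sym2 V → ℝ)
    (R S : Set V) (T : V → RootedTree G) : Prop where
  root_eq : ∀ s ∈ S, (T s).root = s
  subgraph : ∀ s ∈ S, (T s).graph ≤ minus G R
  stretch : ∀ a ∈ S, ∀ b ∉ R, (minus G R).spanningCoe.Reachable a b →
    ∃ s ∈ S, a ∈ (T s).graph.verts ∧ b ∈ (T s).graph.verts ∧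
      (T s).dep w a + (T s).dep w b ≤
        (2 * kpar V - 1) * wdist (minus G R).spanningCoe w a b
  overlap : ∀ b ∉ R, (({s | s ∈ S ∧ b ∈ (T s).graph.verts} : Set V).ncard : ℝ) ≤
    kpar V * (Fintype.card V : ℝ) ^ (1 / kpar V) * (Real.log (Fintype.card V) + 1)

/-- `x` is a trunk vertex of the tree `K` of an `S`-restricted tree cover: it lies on the path in
`K` between two vertices of `S`. -/
def IsTrunk {V : Type*} {G : SimpleGraph V} (K : G.Subgraph) (S : Set V) (x : V) : Prop :=
  ∃ a ∈ S ∩ K.verts, ∃ b ∈ S ∩ K.verts,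
    ∃ q : K.spanningCoe.Walk a b, q.IsPath ∧ x ∈ q.support

/-- The pseudo-degree of `x`: its degree in the subgraph of `K` induced by the trunk vertices
(`0` if `x` is not a trunk vertex). -/
noncomputable def pdeg {V : Type*} {G : SimpleGraph V} (K : G.Subgraph) (S : Set V) (x : V) : ℕ :=
  ((K.induce {y | IsTrunk K S y}).neighborSet x).ncard

/-! ### The high-degree hierarchy

`𝒯 R S` stands for the `S`-restricted tree cover `𝒯(S)` of the graph `G - R`; thus the
notation `𝒯_R(S)` of the hierarchy means `𝒯 R (S \ R)`. -/

/-- The degree threshold `s = 4 e d^{c+1} ln² n + 1`. -/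
noncomputable def threshold (V : Type*) [Fintype V] (d : ℕ) (c : ℝ) : ℝ :=
  4 * Real.exp 1 * (d : ℝ) ^ (c + 1) * Real.log (Fintype.card V) ^ 2 + 1

/-- The set `Hi` of vertices whose pseudo-degree exceeds the threshold in some tree of the
`S`-restricted tree cover `T`. -/
def Hi {V : Type*} [Fintype V] {G : SimpleGraph V} (d : ℕ) (c : ℝ) (S : Set V)
    (T : V → RootedTree G) : Set V :=
  {x | ∃ s ∈ S, threshold V d c < (pdeg (T s).graph S x : ℝ)}

/-- The sets `W_0 = ∅`, `W_1 = Hi(𝒯(A))`, `W_{j+1} = W_j ∪ Hi(𝒯_{W_j}(A))` attached to the node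
`A` of the hierarchy tree. -/
def child {V : Type*} [Fintype V] {G : SimpleGraph V} (𝒯 : Set V → Set V → V → RootedTree G)
    (d : ℕ) (c : ℝ) (A : Set V) : ℕ → Set V
  | 0 => ∅
  | j + 1 => child 𝒯 d c A j ∪
      Hi d c (A \ child 𝒯 d c A j) (𝒯 (child 𝒯 d c A j) (A \ child 𝒯 d c A j))

/-- `U 1, …, U p` is a path in the hierarchy tree that starts at the root `V`, and `U (p+1) = ∅`.
A node `A` with `Hi(𝒯(A)) = ∅` is a leaf; any other node has the children `W_1, …, W_d`. -/
structure IsHierarchyPath {V : Type*} [Fintype V] {G : SimpleGraph V}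
    (𝒯 : Set V → Set V → V → RootedTree G) (d : ℕ) (c : ℝ) (p : ℕ) (U : ℕ → Set V) : Prop where
  one_le : 1 ≤ p
  root : U 1 = Set.univ
  step : ∀ i, 1 ≤ i → i < p →
    (Hi d c (U i) (𝒯 ∅ (U i))).Nonempty ∧ ∃ j, 1 ≤ j ∧ j ≤ d ∧ U (i + 1) = child 𝒯 d c (U i) j
  last : U (p + 1) = ∅

/-! ### The pruned trees -/

/-- The tree obtained from `T` by deleting the vertices of depth more than `(2k-1)ρ`. -/
noncomputable def prune {V : Type*} [Fintype V] {G : SimpleGraph V} (w : Sym2 V → ℝ) (ρ : ℝ)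
    (T : RootedTree G) : G.Subgraph :=
  T.graph.deleteVerts {x | (2 * kpar V - 1) * ρ < T.dep w x}

/-- An indexed family of trees; the tree with index `(i, r)` has root `r` and belongs to a
`src (i, r)`-restricted tree cover. -/
structure TreeFamily {V : Type*} (G : SimpleGraph V) where
  /-- the index set -/
  idx : Set (ℕ × V)
  /-- the trees -/
  tree : ℕ × V → G.Subgraph
  /-- the set to which the tree cover of the tree is restricted -/
  src : ℕ × V → Set V

/-- The family of the pruned trees of `⋃_{1 ≤ i ≤ p} 𝒯_{U_{i+1}}(U_i)`. -/
noncomputable def prunedFamily {V : Type*} [Fintype V] {G : SimpleGraph V} (w : Sym2 V → ℝ)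
    (𝒯 : Set V → Set V → V → RootedTree G) (p : ℕ) (U : ℕ → Set V) (ρ : ℝ) : TreeFamily G where
  idx := {t | 1 ≤ t.1 ∧ t.1 ≤ p ∧ t.2 ∈ U t.1 \ U (t.1 + 1)}
  tree t := prune w ρ (𝒯 (U (t.1 + 1)) (U t.1 \ U (t.1 + 1)) t.2)
  src t := U t.1 \ U (t.1 + 1)

/-! ### Euler tours, covering sets -/

/-- `l` is the sequence of the vertices of `K`, in the order in which some depth-first search that
starts at `r` discovers them: each new vertex is adjacent to the most recently discovered vertex
that still has an undiscovered neighbour. -/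
def IsEulerTour {V : Type*} {G : SimpleGraph V} (K : G.Subgraph) (r : V) (l : List V) : Prop :=
  l.head? = some r ∧ l.Nodup ∧ (∀ x, x ∈ l ↔ x ∈ K.verts) ∧
    ∀ (j : ℕ) (hj : j + 1 < l.length), ∃ (i : ℕ) (hi : i ≤ j),
      K.Adj (l[i]'(by omega)) l[j + 1] ∧
        ∀ (m : ℕ) (hm : m ≤ j), i < m → ∀ y, K.Adj (l[m]'(by omega)) y → y ∈ l.take (j + 1)

/-- A listing of the trees of the family together with an Euler tour of each of them. -/
structure Layout {V : Type*} {G : SimpleGraph V} (F : TreeFamily G) where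
  /-- the order in which the trees are listed -/
  order : List (ℕ × V)
  nodup : order.Nodup
  mem_order : ∀ t, t ∈ order ↔ t ∈ F.idx
  /-- the Euler tours -/
  tour : ℕ × V → List V
  isEulerTour : ∀ t ∈ F.idx, IsEulerTour (F.tree t) t.2 (tour t)

/-- The concatenation `Λ` of the Euler tours. -/
def Layout.seq {V : Type*} {G : SimpleGraph V} {F : TreeFamily G} (L : Layout F) : List V :=
  L.order.flatMap L.tour

/-- The (nonempty) intervals of positions of `Λ`. -/
abbrev Layout.Interval {V : Type*} {G : SimpleGraph V} {F : TreeFamily G} (L : Layout F) : Type :=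
  NonemptyInterval (Fin L.seq.length)

/-- The vertices that occur in an interval of `Λ`. -/
def Layout.vertices {V : Type*} {G : SimpleGraph V} {F : TreeFamily G} (L : Layout F)
    (I : L.Interval) : Set V :=
  {x | ∃ i ∈ I, L.seq.get i = x}

/-- `𝓘` is a `κ`-covering set: each interval is the union of at most `κ` members of `𝓘`. -/
def IsCoveringSet {N : ℕ} (κ : ℕ) (𝓘 : Set (NonemptyInterval (Fin N))) : Prop :=
  ∀ J : NonemptyInterval (Fin N), ∃ A : Finset (NonemptyInterval (Fin N)),
    (A : Set (NonemptyInterval (Fin N))) ⊆ 𝓘 ∧ A.card ≤ κ ∧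
      (⋃ I ∈ A, (I : Set (Fin N))) = (J : Set (Fin N))

/-! ### The auxiliary digraph `H` and the table `E'` -/

/-- The vertices of the digraph `H`: two copies of the intervals, two copies of the trees, and one
copy of `V`. -/
inductive HVertex {V : Type*} {G : SimpleGraph V} {F : TreeFamily G} (L : Layout F) : Type _
  | int₁ (I : L.Interval)
  | tree₁ (t : ℕ × V)
  | vert (x : V)
  | tree₂ (t : ℕ × V)
  | int₂ (I : L.Interval)

/-- There is an edge of `G` of weight at most `ρ` from some vertex of the interval `I` to some
vertex of the tree with index `t`. -/
def Near {V : Type*} {G : SimpleGraph V} (w : Sym2 V → ℝ) (ρ : ℝ) {F : TreeFamily G}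
    (L : Layout F) (I : L.Interval) (t : ℕ × V) : Prop :=
  ∃ x ∈ L.vertices I, ∃ y ∈ (F.tree t).verts, G.Adj x y ∧ w s(x, y) ≤ ρ

/-- The directed edges of `H`. -/
inductive HEdge {V : Type*} {G : SimpleGraph V} (w : Sym2 V → ℝ) (ρ : ℝ) {F : TreeFamily G}
    (L : Layout F) (𝓘 : Set L.Interval) : HVertex L → HVertex L → Prop
  | int_tree (I : L.Interval) (t : ℕ × V) (hI : I ∈ 𝓘) (ht : t ∈ F.idx)
      (h : Near w ρ L I t) : HEdge w ρ L 𝓘 (.int₁ I) (.tree₁ t)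
  | tree_int (I : L.Interval) (t : ℕ × V) (hI : I ∈ 𝓘) (ht : t ∈ F.idx)
      (h : Near w ρ L I t) : HEdge w ρ L 𝓘 (.tree₂ t) (.int₂ I)
  | tree_vert (t : ℕ × V) (x : V) (ht : t ∈ F.idx) (hx : x ∈ (F.tree t).verts) :
      HEdge w ρ L 𝓘 (.tree₁ t) (.vert x)
  | vert_tree (t : ℕ × V) (x : V) (ht : t ∈ F.idx) (hx : x ∈ (F.tree t).verts) :
      HEdge w ρ L 𝓘 (.vert x) (.tree₂ t)

/-- The table `E'`: pairs of positions of `Λ` that carry the same vertex or the end points of an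
edge of weight at most `ρ`. -/
def TableE {V : Type*} {G : SimpleGraph V} (w : Sym2 V → ℝ) (ρ : ℝ) {F : TreeFamily G}
    (L : Layout F) : Set (Fin L.seq.length × Fin L.seq.length) :=
  {z | L.seq.get z.1 = L.seq.get z.2 ∨
    (G.Adj (L.seq.get z.1) (L.seq.get z.2) ∧ w s(L.seq.get z.1, L.seq.get z.2) ≤ ρ)}

/-! ### Affected trees, subtrees and vertices -/

/-- The tree with index `t` is an affected tree. -/
def IsAffectedTree {V : Type*} {G : SimpleGraph V} (F : TreeFamily G) (D : Set V)
    (t : ℕ × V) : Prop :=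
  t ∈ F.idx ∧ ((F.tree t).verts ∩ D).Nonempty

/-- `C` is the vertex set of a connected component of the forest `K - D`. -/
def IsComponent {V : Type*} {G : SimpleGraph V} (K : G.Subgraph) (D C : Set V) : Prop :=
  ∃ x ∈ K.verts \ D, C = {y | (K.deleteVerts D).spanningCoe.Reachable x y}

/-- `C` is (the vertex set of) an affected subtree of the affected tree with index `t`: a component
that contains a trunk vertex. -/
def IsAffectedSubtree {V : Type*} {G : SimpleGraph V} (F : TreeFamily G) (D : Set V)
    (t : ℕ × V) (C : Set V) : Prop :=
  IsAffectedTree F D t ∧ IsComponent (F.tree t) D C ∧ ∃ x ∈ C, IsTrunk (F.tree t) (F.src t) x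

/-- `x` is an affected vertex: it lies in some affected subtree. -/
def IsAffectedVertex {V : Type*} {G : SimpleGraph V} (F : TreeFamily G) (D : Set V)
    (x : V) : Prop :=
  ∃ t C, IsAffectedSubtree F D t C ∧ x ∈ C

/-- There is an unaffected path of length at most `ρ` in `G - D` that connects `X` and `Y`: all its
vertices except possibly the two end points are unaffected. (It may even repeat vertices.) -/
def HasUnaffectedPath {V : Type*} {G : SimpleGraph V} (w : Sym2 V → ℝ) (ρ : ℝ)
    (F : TreeFamily G) (D X Y : Set V) : Prop :=
  ∃ x ∈ X, ∃ y ∈ Y, ∃ q : G.Walk x y, (∀ z ∈ q.support, z ∉ D) ∧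
    (∀ i, 0 < i → i < q.length → ¬ IsAffectedVertex F D (q.getVert i)) ∧ wlen w q ≤ ρ

/-! ### The query graph `R` -/

/-- Labels for the nodes of `R`: the nodes `{u}` and `{v}`, and subtrees `C` of the tree with
index `t`. -/
inductive RNode (V : Type*) : Type _
  | source
  | target
  | sub (t : ℕ × V) (C : Set V)

/-- The vertex set of a node. -/
def RNode.carrier {V : Type*} (u v : V) : RNode V → Set V
  | .source => {u}
  | .target => {v}
  | .sub _ C => C

/-- The node set of `R`: the nodes `{u}` and `{v}`, and all affected subtrees. -/
def RNode.IsNode {V : Type*} {G : SimpleGraph V} (F : TreeFamily G) (D : Set V) :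
    RNode V → Prop
  | .source => True
  | .target => True
  | .sub t C => IsAffectedSubtree F D t C

/-- `rep` represents every node of `R` as a union of intervals from `𝓘`. -/
def IsRepresentation {V : Type*} {G : SimpleGraph V} {F : TreeFamily G} (D : Set V) (u v : V)
    (L : Layout F) (𝓘 : Set L.Interval) (rep : RNode V → Set L.Interval) : Prop :=
  ∀ X : RNode V, X.IsNode F D → rep X ⊆ 𝓘 ∧ X.carrier u v = ⋃ I ∈ rep X, L.vertices I

/-- `a` can reach `b` in `H` after the removal of both copies of every affected tree. -/
def Reaches {V : Type*} {G : SimpleGraph V} (w : Sym2 V → ℝ) (ρ : ℝ) {F : TreeFamily G}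
    (D : Set V) (L : Layout F) (𝓘 : Set L.Interval) : HVertex L → HVertex L → Prop :=
  let removed : Set (HVertex L) :=
    {a | ∃ t, IsAffectedTree F D t ∧ (a = .tree₁ t ∨ a = .tree₂ t)}
  Relation.ReflTransGen fun a b => HEdge w ρ L 𝓘 a b ∧ a ∉ removed ∧ b ∉ removed

/-- The test that the query algorithm performs for the ordered pair `(X, Y)`. -/
def PairTest {V : Type*} {G : SimpleGraph V} (w : Sym2 V → ℝ) (ρ : ℝ) {F : TreeFamily G}
    (D : Set V) (L : Layout F) (𝓘 : Set L.Interval) (rep : RNode V → Set L.Interval)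
    (X Y : RNode V) : Prop :=
  ∃ I ∈ rep X, ∃ J ∈ rep Y,
    Reaches w ρ D L 𝓘 (.int₁ I) (.int₂ J) ∨
      (TableE w ρ L ∩ ((I : Set (Fin L.seq.length)) ×ˢ (J : Set (Fin L.seq.length)))).Nonempty

/-- The (undirected) edge relation `E(R)` on the nodes of `R`. -/
def REdge {V : Type*} {G : SimpleGraph V} (w : Sym2 V → ℝ) (ρ : ℝ) {F : TreeFamily G}
    (D : Set V) (L : Layout F) (𝓘 : Set L.Interval) (rep : RNode V → Set L.Interval)
    (X Y : RNode V) : Prop :=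
  X.IsNode F D ∧ Y.IsNode F D ∧
    (PairTest w ρ D L 𝓘 rep X Y ∨ PairTest w ρ D L 𝓘 rep Y X)

end VSDO

/-!
Consider an unaffected path of length at most `ρ` with interior `r`, and let `i` be the last level
of the hierarchy path whose set `U i` meets `r`. Then `r` runs in `G - U (i + 1)` and contains a
source `a ∈ U i \ U (i + 1)` of the tree cover of that level, so the stretch bound puts each end of
`r` into a common pruned tree with `a`. A source is a trunk vertex of each tree through it, so if
one of these two trees met `D`, then `a` would be affected. Hence both trees survive the deletion,
and `H` joins the two intervals through the first tree, the vertex `a` and the second tree.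

Conversely, a walk of `H` between intervals goes through two surviving trees with a common vertex.
These trees have diameter at most `2(2k-1)ρ` and are attached to the intervals by edges of weight at
most `ρ`; in total `2ρ + 2 · 2(2k-1)ρ = (8k-2)ρ`.
-/

namespace VSDO

open SimpleGraph

section Walks

variable {V : Type*} {H : SimpleGraph V} {w : Sym2 V → ℝ} {a b c : V}

@[simp] theorem wlen_nil : wlen w (Walk.nil : H.Walk a a) = 0 := by simp [wlen]

@[simp] theorem wlen_cons (h : H.Adj a b) (q : H.Walk b c) :
    wlen w (Walk.cons h q) = w s(a, b) + wlen w q := by simp [wlen]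

@[simp] theorem wlen_append (q : H.Walk a b) (r : H.Walk b c) :
    wlen w (q.append r) = wlen w q + wlen w r := by simp [wlen]

@[simp] theorem wlen_concat (q : H.Walk a b) (h : H.Adj b c) :
    wlen w (q.concat h) = wlen w q + w s(b, c) := by
  simp [Walk.concat_eq_append]

@[simp] theorem wlen_reverse (q : H.Walk a b) : wlen w q.reverse = wlen w q := by
  simp [wlen, List.sum_reverse]

@[simp] theorem wlen_mapLe {H' : SimpleGraph V} (h : H ≤ H') (q : H.Walk a b) :
    wlen w (q.mapLe h) = wlen w q := by
  simp [wlen]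

theorem wlen_le_of_edges_sublist (hw : ∀ e ∈ H.edgeSet, 0 ≤ w e) {a' b' : V} {q : H.Walk a b}
    {r : H.Walk a' b'} (h : q.edges.Sublist r.edges) : wlen w q ≤ wlen w r :=
  (h.map w).sum_le_sum <| List.forall_mem_map.2 fun e he => hw e (r.edges_subset_edgeSet he)

theorem wlen_nonneg (hw : ∀ e ∈ H.edgeSet, 0 ≤ w e) (q : H.Walk a b) : 0 ≤ wlen w q :=
  (wlen_nil (a := a)).ge.trans (wlen_le_of_edges_sublist hw (List.nil_sublist _))

theorem wdist_le (hw : ∀ e ∈ H.edgeSet, 0 ≤ w e) (q : H.Walk a b) : wdist H w a b ≤ wlen w q :=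
  csInf_le ⟨0, Set.forall_mem_range.2 (wlen_nonneg hw)⟩ ⟨q, rfl⟩

theorem wdist_nonneg (hw : ∀ e ∈ H.edgeSet, 0 ≤ w e) (a b : V) : 0 ≤ wdist H w a b :=
  Real.sInf_nonneg (Set.forall_mem_range.2 (wlen_nonneg hw))

theorem exists_wlen_eq_wdist [Finite V] (hw : ∀ e ∈ H.edgeSet, 0 ≤ w e)
    (hab : H.Reachable a b) : ∃ q : H.Walk a b, wlen w q = wdist H w a b := by
  classical
  have := Fintype.ofFinite V
  have : Nonempty (H.Path a b) := hab.elim fun q => ⟨q.toPath⟩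
  obtain ⟨q, hq⟩ := Finite.exists_min fun q : H.Path a b => wlen w q.1
  refine ⟨q.1, le_antisymm (le_csInf ⟨_, q.1, rfl⟩ ?_) (wdist_le hw _)⟩
  rintro _ ⟨r, rfl⟩
  exact (hq r.toPath).trans (wlen_le_of_edges_sublist hw r.edges_bypass_sublist_edges)

theorem eq_or_adj_of_length_le_one (q : H.Walk a b) (hq : q.length ≤ 1) :
    a = b ∨ H.Adj a b ∧ wlen w q = w s(a, b) := by
  match q, hq with
  | .nil, _ => exact .inl rfl
  | .cons h .nil, _ => exact .inr ⟨h, by simp⟩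

theorem exists_interior_of_one_lt_length (q : H.Walk a b) (hq : 1 < q.length) :
    ∃ (x y : V) (r : H.Walk x y), H.Adj a x ∧ H.Adj y b ∧
      (∀ z ∈ r.support, ∃ i, 0 < i ∧ i < q.length ∧ q.getVert i = z) ∧
      wlen w q = w s(a, x) + wlen w r + w s(y, b) := by
  match q, hq with
  | .cons h (.cons h₁ q), _ =>
    obtain ⟨y, r, h', hr⟩ := Walk.exists_cons_eq_concat h₁ q
    rw [hr]
    refine ⟨_, y, r, h, h', fun z hz => ?_, by rw [wlen_cons, wlen_concat, add_assoc]⟩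
    obtain ⟨m, rfl, hm⟩ := Walk.mem_support_iff_exists_getVert.1 hz
    refine ⟨m + 1, m.succ_pos, by simpa [Nat.lt_succ_iff] using hm, ?_⟩
    rw [Walk.getVert_cons_succ, Walk.concat_eq_append, Walk.getVert_append', if_pos hm]

end Walks

section JoinedWithin

variable {V : Type*} {G : SimpleGraph V} {w : Sym2 V → ℝ} {A B : Set V} {M N : ℝ} {x y z : V}

/-- `x` and `y` are joined by a walk of `G` that stays in `A` and has length at most `M`. Walks
rather than paths are used so that the relation composes; see `JoinedWithin.exists_isPath`. -/
def JoinedWithin (G : SimpleGraph V) (w : Sym2 V → ℝ) (A : Set V) (M : ℝ) (x y : V) : Prop :=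
  ∃ q : G.Walk x y, (∀ z ∈ q.support, z ∈ A) ∧ wlen w q ≤ M

namespace JoinedWithin

theorem refl (hx : x ∈ A) (hM : 0 ≤ M) : JoinedWithin G w A M x x :=
  ⟨.nil, by simpa using hx, by simpa using hM⟩

theorem of_adj (h : G.Adj x y) (hM : w s(x, y) ≤ M) (hx : x ∈ A) (hy : y ∈ A) :
    JoinedWithin G w A M x y :=
  ⟨.cons h .nil, by simpa using ⟨hx, hy⟩, by simpa using hM⟩

theorem symm (h : JoinedWithin G w A M x y) : JoinedWithin G w A M y x := by
  obtain ⟨q, hq, hM⟩ := h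
  exact ⟨q.reverse, by simpa using hq, by simpa using hM⟩

theorem trans (h : JoinedWithin G w A M x y) (h' : JoinedWithin G w A N y z) :
    JoinedWithin G w A (M + N) x z := by
  obtain ⟨q, hq, hM⟩ := h
  obtain ⟨r, hr, hN⟩ := h'
  exact ⟨q.append r, fun v hv => (Walk.mem_support_append_iff _ _ |>.1 hv).elim (hq v) (hr v),
    by rw [wlen_append]; exact add_le_add hM hN⟩

theorem mono (h : JoinedWithin G w A M x y) (hAB : A ⊆ B) (hMN : M ≤ N) :
    JoinedWithin G w B N x y := by
  obtain ⟨q, hq, hM⟩ := h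
  exact ⟨q, fun v hv => hAB (hq v hv), hM.trans hMN⟩

theorem exists_isPath (hw : ∀ e ∈ G.edgeSet, 0 ≤ w e) (h : JoinedWithin G w A M x y) :
    ∃ q : G.Walk x y, q.IsPath ∧ (∀ z ∈ q.support, z ∈ A) ∧ wlen w q ≤ M := by
  classical
  obtain ⟨q, hq, hM⟩ := h
  exact ⟨q.bypass, q.bypass_isPath, fun v hv => hq v (q.support_bypass_subset_support hv),
    (wlen_le_of_edges_sublist hw q.edges_bypass_sublist_edges).trans hM⟩

theorem start_of_mem_support (hw : ∀ e ∈ G.edgeSet, 0 ≤ w e) (q : G.Walk x y)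
    (hz : z ∈ q.support) : JoinedWithin G w {v | v ∈ q.support} (wlen w q) x z := by
  classical
  exact ⟨q.takeUntil z hz, fun _ hv => q.support_takeUntil_subset_support hz hv,
    wlen_le_of_edges_sublist hw (q.edges_takeUntil_prefix_edges hz).sublist⟩

theorem end_of_mem_support (hw : ∀ e ∈ G.edgeSet, 0 ≤ w e) (q : G.Walk x y)
    (hz : z ∈ q.support) : JoinedWithin G w {v | v ∈ q.support} (wlen w q) z y := by
  simpa using (start_of_mem_support hw q.reverse (by simpa using hz)).symm

theorem exists_walk_minus {R : Set V} (h : JoinedWithin G w Rᶜ M x y) :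
    ∃ r : (minus G R).spanningCoe.Walk x y, wlen w r ≤ M := by
  obtain ⟨q, hq, hM⟩ := h
  have hedges : ∀ e ∈ q.edges, e ∈ (minus G R).spanningCoe.edgeSet := by
    intro e he
    induction e with
    | _ a b =>
      simpa [minus, q.adj_of_mem_edges he] using
        ⟨hq a (q.fst_mem_support_of_mem_edges he), hq b (q.snd_mem_support_of_mem_edges he)⟩
  exact ⟨q.transfer _ hedges, by simpa [wlen] using hM⟩

end JoinedWithin

end JoinedWithin

section Trees

variable {V : Type*} {G : SimpleGraph V} {w : Sym2 V → ℝ} {ρ : ℝ}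

theorem spanningCoe_weight_nonneg (hw : ∀ e ∈ G.edgeSet, 0 ≤ w e) (K : G.Subgraph) :
    ∀ e ∈ K.spanningCoe.edgeSet, 0 ≤ w e :=
  fun e he => hw e (SimpleGraph.edgeSet_mono K.spanningCoe_le he)

theorem mem_verts_of_mem_support {K : G.Subgraph} {a b z : V} (ha : a ∈ K.verts)
    (q : K.spanningCoe.Walk a b) (hz : z ∈ q.support) : z ∈ K.verts := by
  induction q with
  | nil => exact List.mem_singleton.1 hz ▸ ha
  | cons h q ih =>
    rcases List.mem_cons.1 hz with rfl | hz
    · exact ha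
    · exact ih (h.snd_mem) hz

namespace RootedTree

theorem reachable_root (T : RootedTree G) {x : V} (hx : x ∈ T.graph.verts) :
    T.graph.spanningCoe.Reachable T.root x :=
  (T.isTree.connected.preconnected ⟨T.root, T.root_mem⟩ ⟨x, hx⟩).map
    T.graph.coeEmbeddingSpanningCoe.toHom

theorem dep_nonneg (hw : ∀ e ∈ G.edgeSet, 0 ≤ w e) (T : RootedTree G) (x : V) :
    0 ≤ T.dep w x :=
  wdist_nonneg (spanningCoe_weight_nonneg hw _) _ _

theorem joinedWithin_root [Finite V] (hw : ∀ e ∈ G.edgeSet, 0 ≤ w e) (T : RootedTree G) {x : V}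
    (hx : x ∈ T.graph.verts) :
    JoinedWithin G w {z ∈ T.graph.verts | T.dep w z ≤ T.dep w x} (T.dep w x) T.root x := by
  have hwT := spanningCoe_weight_nonneg hw T.graph
  obtain ⟨q, hq⟩ := exists_wlen_eq_wdist hwT (T.reachable_root hx)
  refine ⟨q.mapLe T.graph.spanningCoe_le, fun z hz => ?_, ((wlen_mapLe _ q).trans hq).le⟩
  have hz : z ∈ q.support := by simpa using hz
  obtain ⟨r, -, hr⟩ := JoinedWithin.start_of_mem_support hwT q hz
  exact ⟨mem_verts_of_mem_support T.root_mem q hz, ((wdist_le hwT r).trans hr).trans hq.le⟩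

end RootedTree

section Prune

variable [Fintype V]

theorem mem_prune {T : RootedTree G} {x : V} :
    x ∈ (prune w ρ T).verts ↔ x ∈ T.graph.verts ∧ T.dep w x ≤ (2 * kpar V - 1) * ρ := by
  simp [prune]

theorem joinedWithin_prune (hw : ∀ e ∈ G.edgeSet, 0 ≤ w e) (T : RootedTree G) {x y : V}
    (hx : x ∈ (prune w ρ T).verts) (hy : y ∈ (prune w ρ T).verts) :
    JoinedWithin G w (prune w ρ T).verts (2 * ((2 * kpar V - 1) * ρ)) x y := by
  have to_root {z : V} (hz : z ∈ (prune w ρ T).verts) :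
      JoinedWithin G w (prune w ρ T).verts ((2 * kpar V - 1) * ρ) T.root z :=
    (T.joinedWithin_root hw (mem_prune.1 hz).1).mono
      (fun _ hv => mem_prune.2 ⟨hv.1, hv.2.trans (mem_prune.1 hz).2⟩) (mem_prune.1 hz).2
  rw [two_mul (_ * ρ)]
  exact (to_root hx).symm.trans (to_root hy)

theorem half_lt_kpar [Nontrivial V] : 1 / 2 < kpar V := by
  have two_le_card : (2 : ℝ) ≤ Fintype.card V := by exact_mod_cast Fintype.one_lt_card (α := V)
  have log_two_le : Real.log 2 ≤ kpar V := Real.log_le_log two_pos two_le_card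
  linarith [Real.log_two_gt_d9]

theorem IsTreeCover.exists_mem_prune [Nontrivial V] (hw : ∀ e ∈ G.edgeSet, 0 ≤ w e)
    {R S : Set V} {T : V → RootedTree G} (hT : IsTreeCover G w R S T) {a b : V} (ha : a ∈ S)
    (hb : b ∉ R) (hab : JoinedWithin G w Rᶜ ρ a b) :
    ∃ s ∈ S, a ∈ (prune w ρ (T s)).verts ∧ b ∈ (prune w ρ (T s)).verts := by
  obtain ⟨r, hr⟩ := hab.exists_walk_minus
  obtain ⟨s, hs, has, hbs, hdep⟩ := hT.stretch a ha b hb ⟨r⟩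
  have hdist : wdist (minus G R).spanningCoe w a b ≤ ρ :=
    (wdist_le (spanningCoe_weight_nonneg hw _) r).trans hr
  have hbound : (T s).dep w a + (T s).dep w b ≤ (2 * kpar V - 1) * ρ :=
    hdep.trans (mul_le_mul_of_nonneg_left hdist (by linarith [half_lt_kpar (V := V)]))
  exact ⟨s, hs, mem_prune.2 ⟨has, by linarith [(T s).dep_nonneg hw b]⟩,
    mem_prune.2 ⟨hbs, by linarith [(T s).dep_nonneg hw a]⟩⟩

end Prune

end Trees

section TreeFamilies

variable {V : Type*} {G : SimpleGraph V} {w : Sym2 V → ℝ} {ρ M : ℝ} {F : TreeFamily G} {D : Set V}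
  {t : ℕ × V} {x a : V}

namespace TreeFamily

/-- The indices of the trees that avoid `D`, which are those whose copies stay in the digraph `H`
during a query. -/
def unaffected (F : TreeFamily G) (D : Set V) : Set (ℕ × V) :=
  {t ∈ F.idx | Disjoint (F.tree t).verts D}

/-- Every tree of the family has weighted diameter at most `M`, measured inside the tree. -/
def DiamLE (F : TreeFamily G) (w : Sym2 V → ℝ) (M : ℝ) : Prop :=
  ∀ t ∈ F.idx, ∀ x ∈ (F.tree t).verts, ∀ y ∈ (F.tree t).verts,
    JoinedWithin G w (F.tree t).verts M x y

/-- Every walk of length at most `ρ` passes through a hub: a vertex that lies in a common tree with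
either end of the walk and is a source of the tree covers of both trees. This is all that the
analysis of unaffected paths needs to know about the hierarchy. -/
def IsHubCover (F : TreeFamily G) (w : Sym2 V → ℝ) (ρ : ℝ) : Prop :=
  ∀ ⦃x y : V⦄ (q : G.Walk x y), wlen w q ≤ ρ → ∃ a ∈ q.support, ∀ z ∈ ({x, y} : Set V),
    ∃ t ∈ F.idx, a ∈ F.src t ∧ a ∈ (F.tree t).verts ∧ z ∈ (F.tree t).verts

theorem mem_unaffected_iff : t ∈ F.unaffected D ↔ t ∈ F.idx ∧ ¬ IsAffectedTree F D t := by
  simp only [unaffected, IsAffectedTree, Set.mem_ofPred_eq, not_and,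
    Set.not_nonempty_iff_eq_empty, Set.disjoint_iff_inter_eq_empty]
  tauto

end TreeFamily

theorem IsAffectedTree.isAffectedVertex (ht : IsAffectedTree F D t) (ha : a ∈ (F.tree t).verts)
    (haS : a ∈ F.src t) (haD : a ∉ D) : IsAffectedVertex F D a :=
  have ha_trunk : IsTrunk (F.tree t) (F.src t) a :=
    ⟨a, ⟨haS, ha⟩, a, ⟨haS, ha⟩, .nil, .nil, by simp⟩
  ⟨t, _, ⟨ht, ⟨a, ⟨ha, haD⟩, rfl⟩, a, .refl a, ha_trunk⟩, .refl a⟩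

theorem TreeFamily.IsHubCover.exists_unaffected (hF : F.IsHubCover w ρ) {x y : V}
    (q : G.Walk x y) (hq : wlen w q ≤ ρ)
    (hqD : ∀ z ∈ q.support, z ∉ D ∧ ¬ IsAffectedVertex F D z) :
    ∃ t ∈ F.unaffected D, ∃ t' ∈ F.unaffected D, x ∈ (F.tree t).verts ∧
      y ∈ (F.tree t').verts ∧ ((F.tree t).verts ∩ (F.tree t').verts).Nonempty := by
  obtain ⟨a, haq, ha⟩ := hF q hq
  obtain ⟨t, ht, hat, hta, htx⟩ := ha x (by simp)
  obtain ⟨t', ht', hat', hta', hty⟩ := ha y (by simp)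
  obtain ⟨haD, ha_unaff⟩ := hqD a haq
  exact ⟨t, mem_unaffected_iff.2 ⟨ht, fun h => ha_unaff (h.isAffectedVertex hta hat haD)⟩,
    t', mem_unaffected_iff.2 ⟨ht', fun h => ha_unaff (h.isAffectedVertex hta' hat' haD)⟩,
    htx, hty, a, hta, hta'⟩

theorem IsComponent.subset {K : G.Subgraph} {C : Set V} (hC : IsComponent K D C) :
    C ⊆ K.verts \ D := by
  obtain ⟨x, hx, rfl⟩ := hC
  rintro y ⟨q⟩
  exact mem_verts_of_mem_support (K := K.deleteVerts D) hx q q.end_mem_support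

theorem RNode.IsNode.carrier_subset_compl {X : RNode V} (hX : X.IsNode F D) {u v : V}
    (hu : u ∉ D) (hv : v ∉ D) : X.carrier u v ⊆ Dᶜ := by
  cases X with
  | source => exact Set.singleton_subset_iff.2 hu
  | target => exact Set.singleton_subset_iff.2 hv
  | sub t C => exact fun _ hx => (hX.2.1.subset hx).2

end TreeFamilies

section Reaches

variable {V : Type*} {G : SimpleGraph V} {w : Sym2 V → ℝ} {ρ : ℝ} {F : TreeFamily G} {D : Set V}
  {L : Layout F} {𝓘 : Set L.Interval} {I J : L.Interval} {t : ℕ × V} {x : V}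

theorem near_of_reaches_tree₂ (h : Reaches w ρ D L 𝓘 (.tree₂ t) (.int₂ J)) :
    Near w ρ L J t := by
  obtain h | ⟨_, ⟨h₁, -⟩, h⟩ := Relation.ReflTransGen.cases_head h
  · cases h
  cases h₁ with | tree_int _ _ _ _ hnear =>
  obtain h | ⟨_, ⟨h₂, -⟩, -⟩ := Relation.ReflTransGen.cases_head h
  · cases h
    exact hnear
  · cases h₂

theorem exists_tree_of_reaches_vert (h : Reaches w ρ D L 𝓘 (.vert x) (.int₂ J)) :
    ∃ t ∈ F.unaffected D, x ∈ (F.tree t).verts ∧ Near w ρ L J t := by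
  obtain h | ⟨_, ⟨h₁, -, hkept⟩, h⟩ := Relation.ReflTransGen.cases_head h
  · cases h
  cases h₁ with | vert_tree t _ ht hx =>
  exact ⟨t, TreeFamily.mem_unaffected_iff.2 ⟨ht, fun h => hkept ⟨t, h, .inr rfl⟩⟩, hx,
    near_of_reaches_tree₂ h⟩

theorem exists_trees_of_reaches (h : Reaches w ρ D L 𝓘 (.int₁ I) (.int₂ J)) :
    ∃ t ∈ F.unaffected D, ∃ t' ∈ F.unaffected D, Near w ρ L I t ∧ Near w ρ L J t' ∧
      ((F.tree t).verts ∩ (F.tree t').verts).Nonempty := by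
  obtain h | ⟨_, ⟨h₁, -, hkept⟩, h⟩ := Relation.ReflTransGen.cases_head h
  · cases h
  cases h₁ with | int_tree _ t _ ht hnear =>
  obtain h | ⟨_, ⟨h₂, -⟩, h⟩ := Relation.ReflTransGen.cases_head h
  · cases h
  cases h₂ with | tree_vert _ x _ hx =>
  obtain ⟨t', ht', hx', hnear'⟩ := exists_tree_of_reaches_vert h
  exact ⟨t, TreeFamily.mem_unaffected_iff.2 ⟨ht, fun h => hkept ⟨t, h, .inl rfl⟩⟩, t', ht',
    hnear, hnear', x, hx, hx'⟩

theorem reaches_of_trees (hI : I ∈ 𝓘) (hJ : J ∈ 𝓘) {t t' : ℕ × V} (ht : t ∈ F.unaffected D)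
    (ht' : t' ∈ F.unaffected D) (hIt : Near w ρ L I t) (hJt' : Near w ρ L J t')
    (htt' : ((F.tree t).verts ∩ (F.tree t').verts).Nonempty) :
    Reaches w ρ D L 𝓘 (.int₁ I) (.int₂ J) := by
  obtain ⟨x, hx, hx'⟩ := htt'
  obtain ⟨ht, hta⟩ := TreeFamily.mem_unaffected_iff.1 ht
  obtain ⟨ht', hta'⟩ := TreeFamily.mem_unaffected_iff.1 ht'
  unfold Reaches
  refine .head ⟨.int_tree I t hI ht hIt, ?_, ?_⟩ <| .head ⟨.tree_vert t x ht hx, ?_, ?_⟩ <|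
    .head ⟨.vert_tree t' x ht' hx', ?_, ?_⟩ <| .single ⟨.tree_int J t' hJ ht' hJt', ?_, ?_⟩ <;>
  · rintro ⟨s, hs, h | h⟩ <;> cases h <;> contradiction

theorem exists_joinedWithin_of_reaches {M : ℝ} (hF : F.DiamLE w M)
    (hI : L.vertices I ⊆ Dᶜ) (hJ : L.vertices J ⊆ Dᶜ)
    (h : Reaches w ρ D L 𝓘 (.int₁ I) (.int₂ J)) :
    ∃ x ∈ L.vertices I, ∃ y ∈ L.vertices J, JoinedWithin G w Dᶜ (2 * ρ + 2 * M) x y := by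
  obtain ⟨t, ⟨ht, htD⟩, t', ⟨ht', htD'⟩, ⟨x, hxI, x', hx't, hxx', hwx⟩,
    ⟨y, hyJ, y', hy't', hyy', hwy⟩, m, hmt, hmt'⟩ := exists_trees_of_reaches h
  have enter : JoinedWithin G w Dᶜ ρ x x' :=
    .of_adj hxx' hwx (hI hxI) (htD.subset_compl_right hx't)
  have through : JoinedWithin G w Dᶜ (M + M) x' y' :=
    ((hF t ht x' hx't m hmt).mono htD.subset_compl_right le_rfl).trans
      ((hF t' ht' m hmt' y' hy't').mono htD'.subset_compl_right le_rfl)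
  have leave : JoinedWithin G w Dᶜ ρ y' y :=
    (JoinedWithin.of_adj hyy' hwy (hJ hyJ) (htD'.subset_compl_right hy't')).symm
  exact ⟨x, hxI, y, hyJ, ((enter.trans through).trans leave).mono subset_rfl (by linarith)⟩

theorem exists_joinedWithin_of_mem_tableE (hρ : 0 ≤ ρ) (hI : L.vertices I ⊆ Dᶜ)
    (hJ : L.vertices J ⊆ Dᶜ)
    (h : (TableE w ρ L ∩ ((I : Set (Fin L.seq.length)) ×ˢ (J : Set _))).Nonempty) :
    ∃ x ∈ L.vertices I, ∃ y ∈ L.vertices J, JoinedWithin G w Dᶜ ρ x y := by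
  obtain ⟨⟨i, j⟩, hij, hiI, hjJ⟩ := h
  have hx : L.seq.get i ∈ L.vertices I := ⟨i, hiI, rfl⟩
  have hy : L.seq.get j ∈ L.vertices J := ⟨j, hjJ, rfl⟩
  refine ⟨_, hx, _, hy, ?_⟩
  obtain heq | ⟨hadj, hwij⟩ := hij
  · exact heq ▸ .refl (hI hx) hρ
  · exact .of_adj hadj hwij (hI hx) (hJ hy)

end Reaches

section PairTest

variable {V : Type*} {G : SimpleGraph V} {w : Sym2 V → ℝ} {ρ : ℝ} {F : TreeFamily G} {D : Set V}
  {L : Layout F} {𝓘 : Set L.Interval} {u v : V} {rep : RNode V → Set L.Interval} {X Y : RNode V}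

theorem IsRepresentation.vertices_subset (hrep : IsRepresentation D u v L 𝓘 rep)
    (hX : X.IsNode F D) {I : L.Interval} (hI : I ∈ rep X) : L.vertices I ⊆ X.carrier u v := by
  rw [(hrep X hX).2]
  exact Set.subset_biUnion_of_mem hI

theorem IsRepresentation.exists_mem_vertices (hrep : IsRepresentation D u v L 𝓘 rep)
    (hX : X.IsNode F D) {x : V} (hx : x ∈ X.carrier u v) :
    ∃ I ∈ rep X, I ∈ 𝓘 ∧ x ∈ L.vertices I := by
  rw [(hrep X hX).2] at hx
  obtain ⟨I, hI, hxI⟩ := Set.mem_iUnion₂.1 hx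
  exact ⟨I, hI, (hrep X hX).1 hI, hxI⟩

theorem pairTest_of_hasUnaffectedPath (hw : ∀ e ∈ G.edgeSet, 0 ≤ w e) (hF : F.IsHubCover w ρ)
    (hrep : IsRepresentation D u v L 𝓘 rep) (hX : X.IsNode F D) (hY : Y.IsNode F D)
    (h : HasUnaffectedPath w ρ F D (X.carrier u v) (Y.carrier u v)) :
    PairTest w ρ D L 𝓘 rep X Y := by
  obtain ⟨x, hx, y, hy, q, hqD, hq_unaff, hqρ⟩ := h
  obtain ⟨I, hI, hI𝓘, hxI⟩ := hrep.exists_mem_vertices hX hx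
  obtain ⟨J, hJ, hJ𝓘, hyJ⟩ := hrep.exists_mem_vertices hY hy
  refine ⟨I, hI, J, hJ, ?_⟩
  obtain hq | hq := le_or_gt q.length 1
  · obtain ⟨i, hiI, rfl⟩ := hxI
    obtain ⟨j, hjJ, rfl⟩ := hyJ
    have hij : (i, j) ∈ TableE w ρ L :=
      (eq_or_adj_of_length_le_one (w := w) q hq).imp_right fun ⟨hadj, hwq⟩ =>
        ⟨hadj, hwq.ge.trans hqρ⟩
    exact .inr ⟨(i, j), hij, hiI, hjJ⟩
  · obtain ⟨x', y', r, hxx', hy'y, hr, hwq⟩ := exists_interior_of_one_lt_length (w := w) q hq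
    have hwx := hw _ (G.mem_edgeSet.2 hxx')
    have hwy := hw _ (G.mem_edgeSet.2 hy'y)
    have hwr := wlen_nonneg hw r
    have hr_unaff : ∀ z ∈ r.support, z ∉ D ∧ ¬ IsAffectedVertex F D z := by
      intro z hz
      obtain ⟨i, hi, hiq, rfl⟩ := hr z hz
      exact ⟨hqD _ (q.getVert_mem_support i), hq_unaff i hi hiq⟩
    obtain ⟨t, ht, t', ht', hx't, hy't', htt'⟩ := hF.exists_unaffected r (by linarith) hr_unaff
    exact .inl (reaches_of_trees hI𝓘 hJ𝓘 ht ht' ⟨x, hxI, x', hx't, hxx', by linarith⟩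
      ⟨y, hyJ, y', hy't', hy'y.symm, by rw [Sym2.eq_swap]; linarith⟩ htt')

theorem exists_joinedWithin_of_pairTest {M : ℝ} (hρ : 0 ≤ ρ) (hM : 0 ≤ M) (hF : F.DiamLE w M)
    (hu : u ∉ D) (hv : v ∉ D) (hrep : IsRepresentation D u v L 𝓘 rep) (hX : X.IsNode F D)
    (hY : Y.IsNode F D) (h : PairTest w ρ D L 𝓘 rep X Y) :
    ∃ x ∈ X.carrier u v, ∃ y ∈ Y.carrier u v, JoinedWithin G w Dᶜ (2 * ρ + 2 * M) x y := by
  obtain ⟨I, hI, J, hJ, h⟩ := h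
  have hIX := hrep.vertices_subset hX hI
  have hJY := hrep.vertices_subset hY hJ
  have hID := hIX.trans (hX.carrier_subset_compl hu hv)
  have hJD := hJY.trans (hY.carrier_subset_compl hu hv)
  obtain h | h := h
  · obtain ⟨x, hx, y, hy, hxy⟩ := exists_joinedWithin_of_reaches hF hID hJD h
    exact ⟨x, hIX hx, y, hJY hy, hxy⟩
  · obtain ⟨x, hx, y, hy, hxy⟩ := exists_joinedWithin_of_mem_tableE hρ hID hJD h
    exact ⟨x, hIX hx, y, hJY hy, hxy.mono subset_rfl (by linarith)⟩

theorem exists_joinedWithin_of_rEdge {M : ℝ} (hρ : 0 ≤ ρ) (hM : 0 ≤ M) (hF : F.DiamLE w M)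
    (hu : u ∉ D) (hv : v ∉ D) (hrep : IsRepresentation D u v L 𝓘 rep)
    (h : REdge w ρ D L 𝓘 rep X Y) :
    ∃ x ∈ X.carrier u v, ∃ y ∈ Y.carrier u v, JoinedWithin G w Dᶜ (2 * ρ + 2 * M) x y := by
  obtain ⟨hX, hY, h | h⟩ := h
  · exact exists_joinedWithin_of_pairTest hρ hM hF hu hv hrep hX hY h
  · obtain ⟨y, hy, x, hx, hyx⟩ := exists_joinedWithin_of_pairTest hρ hM hF hu hv hrep hY hX h
    exact ⟨x, hx, y, hy, hyx.symm⟩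

end PairTest

theorem exists_inter_nonempty_and_disjoint_succ {α : Type*} {p : ℕ} {U : ℕ → Set α}
    {A : Set α} (h_one : (A ∩ U 1).Nonempty) (h_last : Disjoint A (U (p + 1))) :
    ∃ i, 1 ≤ i ∧ i ≤ p ∧ (A ∩ U i).Nonempty ∧ Disjoint A (U (i + 1)) := by
  classical
  have h : ∃ i, Disjoint A (U (i + 1)) := ⟨p, h_last⟩
  have h_pos : Nat.find h ≠ 0 := fun h_zero =>
    Set.not_disjoint_iff_nonempty_inter.2 h_one ((Nat.find_eq_zero h).1 h_zero)
  have h_meets := Nat.find_min h (Nat.sub_one_lt h_pos)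
  rw [Nat.sub_one_add_one h_pos, Set.not_disjoint_iff_nonempty_inter] at h_meets
  exact ⟨Nat.find h, Nat.one_le_iff_ne_zero.2 h_pos, Nat.find_min' h h_last, h_meets,
    Nat.find_spec h⟩

section PrunedFamily

variable {V : Type*} [Fintype V] {G : SimpleGraph V} {w : Sym2 V → ℝ}
  {𝒯 : Set V → Set V → V → RootedTree G} {p : ℕ} {U : ℕ → Set V} {ρ : ℝ}

theorem prunedFamily_diamLE (hw : ∀ e ∈ G.edgeSet, 0 ≤ w e) :
    (prunedFamily w 𝒯 p U ρ).DiamLE w (2 * ((2 * kpar V - 1) * ρ)) :=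
  fun _ _ _ hx _ hy => joinedWithin_prune hw _ hx hy

theorem prunedFamily_isHubCover [Nontrivial V] (hw : ∀ e ∈ G.edgeSet, 0 ≤ w e)
    (h𝒯 : ∀ i, 1 ≤ i → i ≤ p →
      IsTreeCover G w (U (i + 1)) (U i \ U (i + 1)) (𝒯 (U (i + 1)) (U i \ U (i + 1))))
    (hU_root : U 1 = Set.univ) (hU_last : U (p + 1) = ∅) :
    (prunedFamily w 𝒯 p U ρ).IsHubCover w ρ := by
  intro x y q hq
  obtain ⟨i, hi, hip, ⟨a, haq, hai⟩, hqU⟩ :=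
    exists_inter_nonempty_and_disjoint_succ (U := U) (p := p) (A := {z | z ∈ q.support})
      ⟨x, q.start_mem_support, hU_root ▸ Set.mem_univ x⟩ (by simp [hU_last])
  have haS : a ∈ U i \ U (i + 1) := ⟨hai, hqU.notMem_of_mem_left haq⟩
  refine ⟨a, haq, fun z hz => ?_⟩
  have hzq : z ∈ q.support ∧ JoinedWithin G w {v | v ∈ q.support} (wlen w q) a z := by
    rcases hz with rfl | rfl
    · exact ⟨q.start_mem_support, (JoinedWithin.start_of_mem_support hw q haq).symm⟩
    · exact ⟨q.end_mem_support, JoinedWithin.end_of_mem_support hw q haq⟩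
  obtain ⟨s, hs, has, hzs⟩ := (h𝒯 i hi hip).exists_mem_prune hw haS
    (hqU.notMem_of_mem_left hzq.1) (hzq.2.mono hqU.subset_compl_right hq)
  exact ⟨(i, s), ⟨hi, hip, hs⟩, haS, has, hzs⟩

end PrunedFamily

end VSDO

theorem mainTheorem8_general {V : Type*} [Fintype V] [Nontrivial V]
    (G : SimpleGraph V) (w : Sym2 V → ℝ) (hw : ∀ e ∈ G.edgeSet, 0 ≤ w e)
    (𝒯 : Set V → Set V → V → VSDO.RootedTree G) (p : ℕ) (U : ℕ → Set V)
    (h𝒯 : ∀ i, 1 ≤ i → i ≤ p →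
      VSDO.IsTreeCover G w (U (i + 1)) (U i \ U (i + 1)) (𝒯 (U (i + 1)) (U i \ U (i + 1))))
    (hU_root : U 1 = Set.univ) (hU_last : U (p + 1) = ∅)
    (ρ : ℝ) (hρ : 0 ≤ ρ)
    (L : VSDO.Layout (VSDO.prunedFamily w 𝒯 p U ρ)) (𝓘 : Set L.Interval)
    (D : Set V) (u v : V) (hu : u ∉ D) (hv : v ∉ D)
    (rep : VSDO.RNode V → Set L.Interval)
    (hrep : VSDO.IsRepresentation D u v L 𝓘 rep)
    (X Y : VSDO.RNode V)
    (hX : X.IsNode (VSDO.prunedFamily w 𝒯 p U ρ) D)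
    (hY : Y.IsNode (VSDO.prunedFamily w 𝒯 p U ρ) D) :
    (VSDO.HasUnaffectedPath w ρ (VSDO.prunedFamily w 𝒯 p U ρ) D
        (X.carrier u v) (Y.carrier u v) →
      VSDO.REdge w ρ D L 𝓘 rep X Y) ∧
    (VSDO.REdge w ρ D L 𝓘 rep X Y →
      ∃ x ∈ X.carrier u v, ∃ y ∈ Y.carrier u v, ∃ q : G.Walk x y,
        q.IsPath ∧ (∀ z ∈ q.support, z ∉ D) ∧
          VSDO.wlen w q ≤ (8 * VSDO.kpar V - 2) * ρ) := by
  have hub := VSDO.prunedFamily_isHubCover (ρ := ρ) hw h𝒯 hU_root hU_last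
  refine ⟨fun h => ⟨hX, hY, .inl (VSDO.pairTest_of_hasUnaffectedPath hw hub hrep hX hY h)⟩,
    fun h => ?_⟩
  have diam_nonneg : 0 ≤ 2 * ((2 * VSDO.kpar V - 1) * ρ) :=
    mul_nonneg zero_le_two (mul_nonneg (by linarith [VSDO.half_lt_kpar (V := V)]) hρ)
  obtain ⟨x, hx, y, hy, hxy⟩ := VSDO.exists_joinedWithin_of_rEdge hρ diam_nonneg
    (VSDO.prunedFamily_diamLE hw) hu hv hrep h
  obtain ⟨q, hq, hqD, hqρ⟩ := hxy.exists_isPath hw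
  exact ⟨x, hx, y, hy, q, hq, hqD, hqρ.trans_eq (by ring)⟩

theorem mainTheorem8 {V : Type*} [Fintype V] (hn : 3 ≤ Fintype.card V)
    (G : SimpleGraph V) (w : Sym2 V → ℝ) (hw : ∀ e ∈ G.edgeSet, 0 < w e)
    (d : ℕ) (hd : 2 ≤ d) (c : ℝ) (hc : 1 ≤ c)
    (𝒯 : Set V → Set V → V → VSDO.RootedTree G)
    (h𝒯 : ∀ R S : Set V, Disjoint R S → VSDO.IsTreeCover G w R S (𝒯 R S))
    (p : ℕ) (U : ℕ → Set V) (hU : VSDO.IsHierarchyPath 𝒯 d c p U)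
    (ρ : ℝ) (hρ : 0 ≤ ρ)
    (L : VSDO.Layout (VSDO.prunedFamily w 𝒯 p U ρ))
    (κ : ℕ) (𝓘 : Set L.Interval) (h𝓘 : VSDO.IsCoveringSet κ 𝓘)
    (D : Set V) (hD : D.ncard ≤ d) (u v : V) (hu : u ∉ D) (hv : v ∉ D)
    (rep : VSDO.RNode V → Set L.Interval)
    (hrep : VSDO.IsRepresentation D u v L 𝓘 rep)
    (X Y : VSDO.RNode V)
    (hX : X.IsNode (VSDO.prunedFamily w 𝒯 p U ρ) D)
    (hY : Y.IsNode (VSDO.prunedFamily w 𝒯 p U ρ) D) :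
    (VSDO.HasUnaffectedPath w ρ (VSDO.prunedFamily w 𝒯 p U ρ) D
        (X.carrier u v) (Y.carrier u v) →
      VSDO.REdge w ρ D L 𝓘 rep X Y) ∧
    (VSDO.REdge w ρ D L 𝓘 rep X Y →
      ∃ x ∈ X.carrier u v, ∃ y ∈ Y.carrier u v, ∃ q : G.Walk x y,
        q.IsPath ∧ (∀ z ∈ q.support, z ∉ D) ∧
          VSDO.wlen w q ≤ (8 * VSDO.kpar V - 2) * ρ) := by
  have : Nontrivial V := Fintype.one_lt_card_iff_nontrivial.1 (by omega)
  exact mainTheorem8_general G w (fun e he => (hw e he).le) 𝒯 p U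
    (fun _ _ _ => h𝒯 _ _ Set.disjoint_sdiff_right) hU.root hU.last ρ hρ L 𝓘 D u v hu hv rep hrep
    X Y hX hY
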